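/- Let $K$ be a field of characteristic $0$ and let $X$ be a set. Algebras are not assumed to be unital. Let $\mathcal{A}s_3\langle X\rangle$ be the free algebra on $X$ in the variety of associative $K$-algebras satisfying the identity \[ abc+bac-bca-cba=0, \] and let $\mathcal{A}s_3\langle X\rangle^{(+)}$ be the same vector space with the anti-commutator $\{u,v\}=uv+vu$ as its product. Let $J\langle X\rangle$ be the free algebra on $X$ in the variety of Jordan $K$-algebras (with commutative product $\{\cdot,\cdot\}$ satisfying the Jordan identity $\{\{\{a,a\},b\},a\}=\{\{a,a\},\{b,a\}\}$) that satisfy in addition the identities \[ \{\{\{a,b\},c\},d\}=\{\{\{a,c\},b\},d\}=\{\{\{a,b\},d\},c\}=\{\{a,b\},\{c,d\}\}. \] Then there is an injective homomorphism of algebras $J\langle X\rangle\to\mathcal{A}s_3\langle X\rangle^{(+)}$ that maps each generator $x\in X$ to $x$. In particular, $J\langle X\rangle$ embeds into a free algebra of the variety $\mathcal{A}s_3$ under the anti-commutator. -/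

import Mathlib

noncomputable section

namespace MalcevThird

universe u v w

/-! ### Varieties of (non-unital, non-associative) algebras given by polynomial identities -/

/-- Non-associative polynomials over `K` in the variables `x₀, x₁, x₂, …`: elements of the free
non-unital non-associative algebra on `ℕ`. The polynomial `p` stands for the identity `p = 0`. -/
abbrev NAPoly (K : Type u) [Field K] : Type u := FreeNonUnitalNonAssocAlgebra K ℕ

/-- The variable `xᵢ`. -/
abbrev var (K : Type u) [Field K] (i : ℕ) : NAPoly K := FreeNonUnitalNonAssocAlgebra.of K i

/-- The T-ideal of the free non-associative algebra on `X` generated by a set `I` of identities: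
the smallest two-sided ideal that contains all values of all members of `I`. -/
def tIdeal (K : Type u) [Field K] (I : Set (NAPoly K)) (X : Type v) :
    Submodule K (FreeNonUnitalNonAssocAlgebra K X) :=
  sInf {T | (∀ p ∈ I, ∀ f : ℕ → FreeNonUnitalNonAssocAlgebra K X,
                FreeNonUnitalNonAssocAlgebra.lift K f p ∈ T) ∧
            ∀ a ∈ T, ∀ b, a * b ∈ T ∧ b * a ∈ T}

section tIdeal

variable {K : Type u} [Field K] {I : Set (NAPoly K)} {X : Type v}

theorem mul_mem_tIdeal {a : FreeNonUnitalNonAssocAlgebra K X} (ha : a ∈ tIdeal K I X)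
    (b : FreeNonUnitalNonAssocAlgebra K X) : a * b ∈ tIdeal K I X ∧ b * a ∈ tIdeal K I X := by
  simp only [tIdeal, Submodule.mem_sInf] at ha ⊢
  exact ⟨fun T hT => (hT.2 a (ha T hT) b).1, fun T hT => (hT.2 a (ha T hT) b).2⟩

end tIdeal

/-- The free algebra on `X` in the variety of `K`-algebras defined by the identities in `I`. -/
def RelFree (K : Type u) [Field K] (I : Set (NAPoly K)) (X : Type v) : Type (max u v) :=
  FreeNonUnitalNonAssocAlgebra K X ⧸ tIdeal K I X

namespace RelFree

variable {K : Type u} [Field K] {I : Set (NAPoly K)} {X : Type v}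

instance : AddCommGroup (RelFree K I X) :=
  inferInstanceAs (AddCommGroup (FreeNonUnitalNonAssocAlgebra K X ⧸ tIdeal K I X))

instance : Module K (RelFree K I X) :=
  inferInstanceAs (Module K (FreeNonUnitalNonAssocAlgebra K X ⧸ tIdeal K I X))

variable (K I) in
/-- The quotient map, as a linear map. -/
def mk : FreeNonUnitalNonAssocAlgebra K X →ₗ[K] RelFree K I X := (tIdeal K I X).mkQ

theorem mk_surjective : Function.Surjective (mk K I (X := X)) :=
  (tIdeal K I X).mkQ_surjective

/-- Multiplication is induced from the free non-associative algebra. -/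
instance : Mul (RelFree K I X) where
  mul := Quotient.map₂ (· * ·) (by
    intro a a' ha b b' hb
    have ha' : a - a' ∈ tIdeal K I X := (Submodule.quotientRel_def _).1 ha
    have hb' : b - b' ∈ tIdeal K I X := (Submodule.quotientRel_def _).1 hb
    refine (Submodule.quotientRel_def _).2 ?_
    have h : a * b - a' * b' = (a - a') * b + a' * (b - b') := by
      rw [sub_mul, mul_sub]; abel
    change a * b - a' * b' ∈ _
    rw [h]
    exact add_mem (mul_mem_tIdeal ha' b).1 (mul_mem_tIdeal hb' a').2)

theorem mk_mul (a b : FreeNonUnitalNonAssocAlgebra K X) :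
    mk K I (a * b) = mk K I a * mk K I b := rfl

instance : NonUnitalNonAssocRing (RelFree K I X) where
  left_distrib a b c := by
    obtain ⟨a, rfl⟩ := mk_surjective a
    obtain ⟨b, rfl⟩ := mk_surjective b
    obtain ⟨c, rfl⟩ := mk_surjective c
    rw [← map_add, ← mk_mul, mul_add, map_add, mk_mul, mk_mul]
  right_distrib a b c := by
    obtain ⟨a, rfl⟩ := mk_surjective a
    obtain ⟨b, rfl⟩ := mk_surjective b
    obtain ⟨c, rfl⟩ := mk_surjective c
    rw [← map_add, ← mk_mul, add_mul, map_add, mk_mul, mk_mul]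
  zero_mul a := by
    obtain ⟨a, rfl⟩ := mk_surjective a
    rw [← map_zero (mk K I (X := X)), ← mk_mul, zero_mul]
  mul_zero a := by
    obtain ⟨a, rfl⟩ := mk_surjective a
    rw [← map_zero (mk K I (X := X)), ← mk_mul, mul_zero]

instance : IsScalarTower K (RelFree K I X) (RelFree K I X) where
  smul_assoc t a b := by
    obtain ⟨a, rfl⟩ := mk_surjective a
    obtain ⟨b, rfl⟩ := mk_surjective b
    simp only [smul_eq_mul]
    rw [← map_smul, ← mk_mul, smul_mul_assoc, map_smul, mk_mul]

instance : SMulCommClass K (RelFree K I X) (RelFree K I X) where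
  smul_comm t a b := by
    obtain ⟨a, rfl⟩ := mk_surjective a
    obtain ⟨b, rfl⟩ := mk_surjective b
    simp only [smul_eq_mul]
    rw [← map_smul, ← mk_mul, ← mk_mul, mul_smul_comm, map_smul]

variable (K I) in
/-- The free generators. -/
def of (x : X) : RelFree K I X := mk K I (FreeNonUnitalNonAssocAlgebra.of K x)

end RelFree

/-! ### The two varieties -/

/-- Third-type associative algebras: the associative law and `abc + bac - bca - cba = 0`. -/
def as3Identities (K : Type u) [Field K] : Set (NAPoly K) :=
  let a := var K 0
  let b := var K 1
  let c := var K 2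
  {(a * b) * c - a * (b * c),
   (a * b) * c + (b * a) * c - (b * c) * a - (c * b) * a}

/-- Jordan algebras (commutativity and the Jordan identity `(a²b)a = a²(ba)`) that satisfy
moreover `((ab)c)d = ((ac)b)d = ((ab)d)c = (ab)(cd)`. -/
def jordanIdentities (K : Type u) [Field K] : Set (NAPoly K) :=
  let a := var K 0
  let b := var K 1
  let c := var K 2
  let d := var K 3
  {a * b - b * a,
   ((a * a) * b) * a - (a * a) * (b * a),
   ((a * b) * c) * d - ((a * c) * b) * d,
   ((a * b) * c) * d - ((a * b) * d) * c,
   ((a * b) * c) * d - (a * b) * (c * d)}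

/-- The free third-type associative algebra on `X`. -/
abbrev FreeAs3 (K : Type u) [Field K] (X : Type v) : Type (max u v) :=
  RelFree K (as3Identities K) X

/-- The free algebra on `X` in the variety of Jordan algebras satisfying the additional
degree-four identities. -/
abbrev FreeJordan4 (K : Type u) [Field K] (X : Type v) : Type (max u v) :=
  RelFree K (jordanIdentities K) X

/-! ### The algebra `A⁽⁺⁾` -/

/-- `A⁽⁺⁾`: the vector space `A` with the anti-commutator `{a, b} = ab + ba` as its product. -/
structure Plus (A : Type w) where
  /-- The element of `A⁽⁺⁾` given by an element of `A`. -/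
  of ::
  /-- The underlying element of `A`. -/
  val : A

namespace Plus

variable {A : Type w}

/-- `A⁽⁺⁾` and `A` have the same elements. -/
def equiv : Plus A ≃ A := ⟨val, of, fun _ => rfl, fun _ => rfl⟩

@[ext] theorem ext' {a b : Plus A} (h : a.val = b.val) : a = b := equiv.injective h

variable [NonUnitalNonAssocRing A]

instance : AddCommGroup (Plus A) := equiv.addCommGroup

@[simp] theorem val_add (a b : Plus A) : (a + b).val = a.val + b.val := rfl

@[simp] theorem val_zero : (0 : Plus A).val = 0 := rfl

instance : Mul (Plus A) := ⟨fun a b => of (a.val * b.val + b.val * a.val)⟩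

@[simp] theorem val_mul (a b : Plus A) : (a * b).val = a.val * b.val + b.val * a.val := rfl

instance : NonUnitalNonAssocRing (Plus A) where
  left_distrib a b c := by ext; simp only [val_mul, val_add, mul_add, add_mul]; abel
  right_distrib a b c := by ext; simp only [val_mul, val_add, mul_add, add_mul]; abel
  zero_mul a := by ext; simp
  mul_zero a := by ext; simp

instance {K : Type u} [Field K] [Module K A] : Module K (Plus A) := equiv.module K

end Plus

end MalcevThird

end

/-! In `FreeAs3` words of length four may be permuted freely (this needs 2 to be invertible), so its
anti-commutator satisfies the identities of `FreeJordan4` and `toPlus` exists. On the Jordan side,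
left-normed products of generators span, and outside degree three such a product depends only on the
multiset of its factors (`genMul_perm`).

Injectivity comes from a linear left inverse, checked on these products; no basis of either algebra
is needed. Away from degree three the passage to commutative polynomials loses nothing: a product of
n generators becomes 2^(n-1) times its monomial. In degree three, where `(ab)c` really depends on
the choice of `c`, polynomials are too coarse. There `FreeAs3` is mapped to the truncated algebra
`Graded3`, whose triple product `tri` satisfies the third-type identity and turns `{{a, b}, c}` back
into `(ab)c`. -/

noncomputable section

open scoped TensorProduct

namespace MalcevThird

universe u v w

/-! ### Universal property of relatively free algebras -/

namespace RelFree

variable {K : Type u} [Field K] {I : Set (NAPoly K)} {X : Type v}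

variable (K I X) in
/-- The quotient map, as a homomorphism of algebras. -/
def mkHom : FreeNonUnitalNonAssocAlgebra K X →ₙₐ[K] RelFree K I X where
  toFun := mk K I
  map_smul' := map_smul (mk K I)
  map_zero' := map_zero (mk K I)
  map_add' := map_add (mk K I)
  map_mul' := mk_mul

theorem mkHom_surjective : Function.Surjective (mkHom K I X) := mk_surjective

@[simp] theorem mkHom_of (x : X) :
    mkHom K I X (FreeNonUnitalNonAssocAlgebra.of K x) = of K I x := rfl

theorem value_mem_tIdeal {p : NAPoly K} (hp : p ∈ I)
    (f : ℕ → FreeNonUnitalNonAssocAlgebra K X) :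
    FreeNonUnitalNonAssocAlgebra.lift K f p ∈ tIdeal K I X := by
  simp only [tIdeal, Submodule.mem_sInf]
  exact fun T hT => hT.1 p hp f

/-- The relatively free algebra satisfies the defining identities. -/
theorem lift_eq_zero {p : NAPoly K} (hp : p ∈ I) (g : ℕ → RelFree K I X) :
    FreeNonUnitalNonAssocAlgebra.lift K g p = 0 := by
  choose f hf using fun n => mkHom_surjective (g n)
  have h : FreeNonUnitalNonAssocAlgebra.lift K g =
      (mkHom K I X).comp (FreeNonUnitalNonAssocAlgebra.lift K f) := by
    refine FreeNonUnitalNonAssocAlgebra.hom_ext K fun n => ?_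
    simp [hf]
  rw [h]
  exact (Submodule.Quotient.mk_eq_zero _).2 (value_mem_tIdeal hp f)

variable {A : Type w} [NonUnitalNonAssocRing A] [Module K A] [IsScalarTower K A A]
  [SMulCommClass K A A]

/-- The kernel is an ideal containing all values of the identities, hence one of the subspaces whose
infimum is `tIdeal`. -/
theorem tIdeal_le_ker (hA : ∀ p ∈ I, ∀ g : ℕ → A, FreeNonUnitalNonAssocAlgebra.lift K g p = 0)
    (F : FreeNonUnitalNonAssocAlgebra K X →ₙₐ[K] A) :
    tIdeal K I X ≤ LinearMap.ker (F : FreeNonUnitalNonAssocAlgebra K X →ₗ[K] A) := by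
  refine sInf_le ⟨fun p hp f => ?_, fun a ha b => ?_⟩
  · have h : FreeNonUnitalNonAssocAlgebra.lift K (fun n => F (f n)) =
        F.comp (FreeNonUnitalNonAssocAlgebra.lift K f) := by
      refine FreeNonUnitalNonAssocAlgebra.hom_ext K fun n => ?_
      simp
    have h0 := hA p hp fun n => F (f n)
    rw [h] at h0
    exact h0
  · have ha' : F a = 0 := ha
    constructor
    · change F (a * b) = 0
      rw [map_mul, ha', zero_mul]
    · change F (b * a) = 0
      rw [map_mul, ha', mul_zero]

/-- The universal property of the relatively free algebra. -/
def lift (hA : ∀ p ∈ I, ∀ g : ℕ → A, FreeNonUnitalNonAssocAlgebra.lift K g p = 0) (f : X → A) :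
    RelFree K I X →ₙₐ[K] A :=
  let F := FreeNonUnitalNonAssocAlgebra.lift K f
  let G : RelFree K I X →ₗ[K] A := (tIdeal K I X).liftQ
    (F : FreeNonUnitalNonAssocAlgebra K X →ₗ[K] A) (tIdeal_le_ker hA F)
  { toFun := G
    map_smul' := map_smul G
    map_zero' := map_zero G
    map_add' := map_add G
    map_mul' := fun a b => by
      obtain ⟨a, rfl⟩ := mk_surjective a
      obtain ⟨b, rfl⟩ := mk_surjective b
      exact map_mul F a b }

@[simp] theorem lift_of
    (hA : ∀ p ∈ I, ∀ g : ℕ → A, FreeNonUnitalNonAssocAlgebra.lift K g p = 0) (f : X → A) (x : X) :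
    lift hA f (of K I x) = f x :=
  FreeNonUnitalNonAssocAlgebra.lift_of_apply K f x

/-- A linear subspace that contains the generators and is closed under multiplication, is
everything. -/
theorem eq_top_of_mul_mem (S : Submodule K (RelFree K I X)) (hof : ∀ x, of K I x ∈ S)
    (hmul : ∀ a ∈ S, ∀ b ∈ S, a * b ∈ S) : S = ⊤ := by
  have hmagma (t : FreeMagma X) : mkHom K I X (MonoidAlgebra.single t 1) ∈ S := by
    induction t with
    | ih1 x => exact hof x
    | ih2 s t hs ht =>
      rw [← one_mul (1 : K), ← MonoidAlgebra.single_mul_single, map_mul]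
      exact hmul _ hs _ ht
  refine eq_top_iff.2 fun a _ => ?_
  obtain ⟨a, rfl⟩ := mkHom_surjective a
  induction a using MonoidAlgebra.induction_linear with
  | zero => simp
  | add f g hf hg => rw [map_add]; exact add_mem (hf trivial) (hg trivial)
  | single t r =>
    have h : (MonoidAlgebra.single t r : FreeNonUnitalNonAssocAlgebra K X) =
        r • MonoidAlgebra.single t 1 := by simp
    rw [h, map_smul]
    exact S.smul_mem _ (hmagma t)

end RelFree

/-! ### Algebras satisfying the identities -/

/-- Associativity and `abc + bac = bca + cba`. -/
structure IsAs3 (A : Type w) [NonUnitalNonAssocRing A] : Prop where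
  assoc : ∀ a b c : A, a * b * c = a * (b * c)
  third : ∀ a b c : A, a * b * c + b * a * c = b * c * a + c * b * a

/-- Commutativity and `((ab)c)d = ((ac)b)d = ((ab)d)c = (ab)(cd)`. -/
structure IsJordan4 (A : Type w) [NonUnitalNonAssocRing A] : Prop where
  comm : ∀ a b : A, a * b = b * a
  swap_mid : ∀ a b c d : A, a * b * c * d = a * c * b * d
  swap_last : ∀ a b c d : A, a * b * c * d = a * b * d * c
  mul_mul : ∀ a b c d : A, a * b * c * d = a * b * (c * d)

section Identities

variable {K : Type u} [Field K] {A : Type w} [NonUnitalNonAssocRing A] [Module K A]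
  [IsScalarTower K A A] [SMulCommClass K A A]

/-- The assignment `x₀ ↦ a, x₁ ↦ b, x₂ ↦ c, xₙ ↦ d` for `n ≥ 3`. -/
def assign (a b c d : A) : ℕ → A
  | 0 => a
  | 1 => b
  | 2 => c
  | _ => d

theorem isAs3_iff : IsAs3 A ↔
    ∀ p ∈ as3Identities K, ∀ g : ℕ → A, FreeNonUnitalNonAssocAlgebra.lift K g p = 0 := by
  constructor
  · rintro h p hp g
    simp only [as3Identities, var, Set.mem_insert_iff, Set.mem_singleton_iff] at hp
    rcases hp with rfl | rfl <;>
      simp only [map_sub, map_add, map_mul, FreeNonUnitalNonAssocAlgebra.lift_of_apply]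
    · rw [h.assoc, sub_self]
    · rw [h.third]; abel
  · intro h
    constructor
    · intro a b c
      have := h _ (Set.mem_insert _ _) (assign a b c 0)
      simpa [var, assign, sub_eq_zero] using this
    · intro a b c
      have := h _ (Set.mem_insert_of_mem _ rfl) (assign a b c 0)
      simp only [var, map_sub, map_add, map_mul,
        FreeNonUnitalNonAssocAlgebra.lift_of_apply, assign] at this
      rwa [sub_sub, sub_eq_zero] at this

/-- The Jordan identity `((aa)b)a = (aa)(ba)` is an instance of `mul_mul`, which is why `IsJordan4`
omits it. -/
theorem isJordan4_iff : IsJordan4 A ↔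
    ∀ p ∈ jordanIdentities K, ∀ g : ℕ → A, FreeNonUnitalNonAssocAlgebra.lift K g p = 0 := by
  constructor
  · rintro h p hp g
    simp only [jordanIdentities, var, Set.mem_insert_iff, Set.mem_singleton_iff] at hp
    rcases hp with rfl | rfl | rfl | rfl | rfl <;>
      simp only [map_sub, map_mul, FreeNonUnitalNonAssocAlgebra.lift_of_apply, sub_eq_zero]
    · exact h.comm _ _
    · exact h.mul_mul _ _ _ _
    · exact h.swap_mid _ _ _ _
    · exact h.swap_last _ _ _ _
    · exact h.mul_mul _ _ _ _
  · intro h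
    simp only [jordanIdentities, var, Set.mem_insert_iff, Set.mem_singleton_iff, forall_eq_or_imp,
      forall_eq, map_sub, map_mul, FreeNonUnitalNonAssocAlgebra.lift_of_apply, sub_eq_zero] at h
    obtain ⟨h1, -, h3, h4, h5⟩ := h
    exact ⟨fun a b => h1 (assign a b 0 0), fun a b c d => h3 (assign a b c d),
      fun a b c d => h4 (assign a b c d), fun a b c d => h5 (assign a b c d)⟩

end Identities

theorem isAs3_freeAs3 (K : Type u) [Field K] (X : Type v) : IsAs3 (FreeAs3 K X) :=
  (isAs3_iff (K := K)).2 fun _ hp => RelFree.lift_eq_zero hp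

theorem isJordan4_freeJordan4 (K : Type u) [Field K] (X : Type v) :
    IsJordan4 (FreeJordan4 K X) :=
  (isJordan4_iff (K := K)).2 fun _ hp => RelFree.lift_eq_zero hp

/-! ### Third-type associative algebras are commutative in degree four -/

section Degree4

/-- The three adjacent transpositions, which generate all permutations of four letters. Each `key`
writes a difference of words as a combination of consequences of the identity: a product substituted
for one variable, or an instance multiplied by a letter. The last transposition is obtained only
after doubling. -/
theorem third_degree_four {A : Type w} [NonUnitalRing A]
    (h : ∀ a b c : A, a * b * c + b * a * c = b * c * a + c * b * a) (a b c d : A) :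
    a * b * c * d = b * a * c * d ∧ a * b * c * d = a * c * b * d ∧
      (2 : ℤ) • (a * b * c * d) = (2 : ℤ) • (a * b * d * c) := by
  have h' (a b c : A) : a * b * c + b * a * c - b * c * a - c * b * a = 0 := by
    rw [h]; abel
  refine ⟨?_, ?_, ?_⟩
  · have key : a * b * c * d - b * a * c * d =
        (d * b * (a * c) + b * d * (a * c) - b * (a * c) * d - a * c * b * d)
        - b * (a * d * c + d * a * c - d * c * a - c * d * a)
        + d * (c * b * a + b * c * a - b * a * c - a * b * c)
        - (d * c * b * a + b * (d * c) * a - b * a * (d * c) - a * b * (d * c))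
        - a * (d * b * c + b * d * c - b * c * d - c * b * d)
        - (b * c * d * a + d * (b * c) * a - d * a * (b * c) - a * d * (b * c)) := by
      simp only [mul_add, mul_sub, mul_assoc]; abel
    have e1 := h' d b (a * c)
    have e2 := h' (d * c) b a
    have e3 := h' (b * c) d a
    rw [← sub_eq_zero, key, e1, e2, e3, h', h', h']; simp
  · have key : a * b * c * d - a * c * b * d =
        (2 : ℤ) • (a * b * c * d + c * (a * b) * d - c * d * (a * b) - d * c * (a * b))
        - c * (b * a * d + a * b * d - a * d * b - d * a * b)
        - a * (b * c * d + c * b * d - c * d * b - d * c * b)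
        - (a * c * d + c * a * d - c * d * a - d * c * a) * b
        - (b * (c * a) * d + c * a * b * d - c * a * d * b - d * (c * a) * b)
        + (b * c * (a * d) + c * b * (a * d) - c * (a * d) * b - a * d * c * b) := by
      simp only [mul_add, mul_sub, add_mul, sub_mul, mul_assoc]; abel
    have e1 := h' (a * b) c d
    have e2 := h' b (c * a) d
    have e3 := h' b c (a * d)
    rw [← sub_eq_zero, key, e1, e2, e3, h', h', h']; simp
  · have key : (2 : ℤ) • (a * b * c * d) - (2 : ℤ) • (a * b * d * c) =
        (d * a * b + a * d * b - a * b * d - b * a * d) * c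
        + (b * a * c + a * b * c - a * c * b - c * a * b) * d
        - (d * a * (b * c) + a * d * (b * c) - a * (b * c) * d - b * c * a * d)
        + (c * a * (b * d) + a * c * (b * d) - a * (b * d) * c - b * d * a * c)
        - b * (c * a * d + a * c * d - a * d * c - d * a * c) := by
      simp only [mul_add, mul_sub, add_mul, sub_mul, mul_assoc]; abel
    have e1 := h' d a (b * c)
    have e2 := h' c a (b * d)
    rw [← sub_eq_zero, key, e1, e2, h', h', h']; simp

theorem IsAs3.isJordan4_plus {K : Type u} [Field K] [CharZero K] {A : Type w}
    [NonUnitalNonAssocRing A] [Module K A] (hA : IsAs3 A) : IsJordan4 (Plus A) := by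
  let _ : NonUnitalRing A := { ‹NonUnitalNonAssocRing A› with mul_assoc := hA.assoc }
  have s12 (a b c d : A) : a * (b * (c * d)) = b * (a * (c * d)) := by
    simpa only [mul_assoc] using (third_degree_four hA.third a b c d).1
  have s23 (a b c d : A) : a * (b * (c * d)) = a * (c * (b * d)) := by
    simpa only [mul_assoc] using (third_degree_four hA.third a b c d).2.1
  have s34 (a b c d : A) : a * (b * (c * d)) = a * (b * (d * c)) := by
    have h := (third_degree_four hA.third a b c d).2.2
    rw [← Int.cast_smul_eq_zsmul K, ← Int.cast_smul_eq_zsmul K] at h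
    have h2 : ((2 : ℤ) : K) ≠ 0 := by norm_num
    simpa only [mul_assoc] using smul_right_injective A h2 h
  refine ⟨fun a b => ?_, fun a b c d => ?_, fun a b c d => ?_, fun a b c d => ?_⟩
  · ext
    simp only [Plus.val_mul]
    abel
  all_goals
    obtain ⟨a⟩ := a
    obtain ⟨b⟩ := b
    obtain ⟨c⟩ := c
    obtain ⟨d⟩ := d
    ext
    simp only [Plus.val_mul, mul_add, add_mul, mul_assoc]
    -- As ordered rewrite rules the transpositions sort every word, so both sides become the same
    -- sum of eight copies of one word.
    simp only [s12, s23, s34]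

end Degree4

/-! ### Left-normed products -/

section ListMul

variable {A : Type w} [NonUnitalNonAssocRing A]

/-- The left-normed product `((xₙ xₙ₋₁) ⋯) x₁` of a list `[x₁, …, xₙ]`, read from its end. -/
def listMul : List A → A
  | [] => 0
  | [x] => x
  | x :: y :: l => listMul (y :: l) * x

theorem listMul_cons (x : A) {l : List A} (hl : l ≠ []) : listMul (x :: l) = listMul l * x := by
  cases l with
  | nil => exact absurd rfl hl
  | cons y l => rfl

theorem exists_listMul_eq_mul {l : List A} (hl : 2 ≤ l.length) :
    ∃ a b : A, listMul l = a * b := by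
  match l, hl with
  | x :: y :: l, _ => exact ⟨_, _, rfl⟩

variable (hA : IsJordan4 A)
include hA

/-- The second clause drives the induction: in length three a permutation can change the product,
but the change disappears after one more multiplication. -/
theorem listMul_perm_aux {l l' : List A} (h : l.Perm l') :
    (l.length ≠ 3 → listMul l = listMul l') ∧ ∀ x, listMul l * x = listMul l' * x := by
  induction h with
  | nil => exact ⟨fun _ => rfl, fun _ => rfl⟩
  | trans h₁ h₂ ih₁ ih₂ =>
    exact ⟨fun h => (ih₁.1 h).trans (ih₂.1 (h₁.length_eq ▸ h)),
      fun x => (ih₁.2 x).trans (ih₂.2 x)⟩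
  | @cons x l l' h ih =>
    rcases eq_or_ne l [] with rfl | hl
    · rw [h.nil_eq]
      exact ⟨fun _ => rfl, fun _ => rfl⟩
    · have hl' : l' ≠ [] := fun h' => hl (by subst h'; exact h.eq_nil)
      have e : listMul (x :: l) = listMul (x :: l') := by
        rw [listMul_cons x hl, listMul_cons x hl', ih.2]
      exact ⟨fun _ => e, fun y => by rw [e]⟩
  | swap x y l =>
    match l with
    | [] =>
      have e : listMul [y, x] = listMul [x, y] := hA.comm x y
      exact ⟨fun _ => e, fun z => by rw [e]⟩
    | [z] => exact ⟨fun h => absurd rfl h, fun w => hA.swap_mid z x y w⟩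
    | a :: b :: l =>
      have e : listMul (y :: x :: a :: b :: l) = listMul (x :: y :: a :: b :: l) :=
        hA.swap_last _ _ _ _
      exact ⟨fun _ => e, fun z => by rw [e]⟩

theorem listMul_perm {l l' : List A} (h : l.Perm l') (hl : l.length ≠ 3) :
    listMul l = listMul l' :=
  (listMul_perm_aux hA h).1 hl

/-- As for permutations, total length three is exceptional until a further factor is present, and
the second clause carries the induction. -/
theorem listMul_append_aux {l l' : List A} (hl : l ≠ []) (hl' : l' ≠ []) :
    (l.length + l'.length ≠ 3 → listMul l * listMul l' = listMul (l ++ l')) ∧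
      ∀ y, listMul l * listMul l' * y = listMul (l ++ l') * y := by
  induction l with
  | nil => exact absurd rfl hl
  | cons x m ih =>
    rcases eq_or_ne m [] with rfl | hm
    · have e : listMul [x] * listMul l' = listMul ([x] ++ l') := by
        rw [List.singleton_append, listMul_cons x hl', hA.comm]
        rfl
      exact ⟨fun _ => e, fun y => by rw [e]⟩
    · obtain ⟨-, ih⟩ := ih hm
      have hm0 := List.length_pos_iff.2 hm
      have hl0 := List.length_pos_iff.2 hl'
      have hml : m ++ l' ≠ [] := by simp [hm]
      rw [List.cons_append, listMul_cons x hm, listMul_cons x hml, ← ih]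
      refine ⟨fun h3 => ?_, fun y => hA.swap_mid _ _ _ _⟩
      -- Moving `x` past `listMul l'` needs one of the other two factors to be a product: `listMul
      -- l'` if `m` is a single letter, `listMul m` otherwise.
      rcases Nat.lt_or_ge m.length 2 with h2 | h2
      · have hl2 : 2 ≤ l'.length := by simp at h3; omega
        obtain ⟨p, q, e⟩ := exists_listMul_eq_mul hl2
        rw [e, ← hA.mul_mul, hA.comm _ (p * q), hA.mul_mul, hA.mul_mul,
          hA.comm (p * q)]
      · obtain ⟨p, q, e⟩ := exists_listMul_eq_mul h2
        rw [e, hA.swap_last]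

/-- In total degree three only commutativity is available, and the order of concatenation depends on
which factor is the single letter. -/
theorem exists_listMul_mul {l l' : List A} (hl : l ≠ []) (hl' : l' ≠ []) :
    listMul l * listMul l' = listMul (l ++ l') ∨ listMul l * listMul l' = listMul (l' ++ l) := by
  by_cases h : l.length + l'.length = 3
  · match l, l', hl, hl', h with
    | [a], [b, c], _, _, _ => exact Or.inl (hA.comm _ _)
    | [a, b], [c], _, _, _ => exact Or.inr rfl
    | [_], _ :: _ :: _ :: _, _, _, h => simp at h; omega
    | [_, _], _ :: _ :: _, _, _, h => simp at h; omega
    | _ :: _ :: _ :: _, _ :: _, _, _, h => simp at h; omega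
  · exact Or.inl ((listMul_append_aux hA hl hl').1 h)

end ListMul

/-- The left-normed product of generators of the free algebra. -/
def genMul (K : Type u) [Field K] {X : Type v} (l : List X) : FreeJordan4 K X :=
  listMul (l.map (RelFree.of K (jordanIdentities K)))

section GenMul

variable {K : Type u} [Field K] {X : Type v}

@[simp] theorem genMul_singleton (x : X) :
    genMul K [x] = RelFree.of K (jordanIdentities K) x := rfl

@[simp] theorem genMul_cons_cons (x y : X) (l : List X) :
    genMul K (x :: y :: l) = genMul K (y :: l) * RelFree.of K (jordanIdentities K) x := rfl

theorem genMul_perm {l l' : List X} (h : l.Perm l') (hl : l.length ≠ 3) :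
    genMul K l = genMul K l' :=
  listMul_perm (isJordan4_freeJordan4 K X) (h.map _) (by simpa using hl)

theorem span_genMul : Submodule.span K {a | ∃ l : List X, l ≠ [] ∧ genMul K l = a} = ⊤ := by
  refine RelFree.eq_top_of_mul_mem _ (fun x => Submodule.subset_span ⟨[x], by simp, rfl⟩) ?_
  intro a ha b hb
  induction ha, hb using Submodule.span_induction₂ with
  | mem_mem a b ha hb =>
    obtain ⟨l, hl, rfl⟩ := ha
    obtain ⟨l', hl', rfl⟩ := hb
    rcases exists_listMul_mul (isJordan4_freeJordan4 K X)
      (l := l.map (RelFree.of K (jordanIdentities K)))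
      (l' := l'.map (RelFree.of K (jordanIdentities K))) (by simpa) (by simpa) with h | h
    · exact Submodule.subset_span ⟨l ++ l', by simp [hl], by
        unfold genMul; rw [h, List.map_append]⟩
    · exact Submodule.subset_span ⟨l' ++ l, by simp [hl], by
        unfold genMul; rw [h, List.map_append]⟩
  | zero_left => rw [zero_mul]; exact zero_mem _
  | zero_right => rw [mul_zero]; exact zero_mem _
  | add_left _ _ _ _ _ _ h1 h2 => rw [add_mul]; exact add_mem h1 h2
  | add_right _ _ _ _ _ _ h1 h2 => rw [mul_add]; exact add_mem h1 h2
  | smul_left r _ _ _ _ h => rw [smul_mul_assoc]; exact Submodule.smul_mem _ r h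
  | smul_right r _ _ _ _ h => rw [mul_smul_comm]; exact Submodule.smul_mem _ r h

end GenMul

/-! ### The anti-commutator algebra over the base field -/

namespace Plus

variable {K : Type u} [Field K] {A : Type w} [NonUnitalNonAssocRing A] [Module K A]

@[simp] theorem val_smul (r : K) (a : Plus A) : (r • a).val = r • a.val := rfl

variable (K A) in
/-- The identity map from `A⁽⁺⁾` to `A`. -/
def valLin : Plus A →ₗ[K] A where
  toFun := val
  map_add' := val_add
  map_smul' := val_smul

instance [IsScalarTower K A A] [SMulCommClass K A A] : IsScalarTower K (Plus A) (Plus A) where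
  smul_assoc r a b := by
    ext; simp only [smul_eq_mul, val_smul, val_mul, smul_mul_assoc, mul_smul_comm, smul_add]

instance [IsScalarTower K A A] [SMulCommClass K A A] : SMulCommClass K (Plus A) (Plus A) where
  smul_comm r a b := by
    ext; simp only [smul_eq_mul, val_smul, val_mul, smul_mul_assoc, mul_smul_comm, smul_add]

end Plus

/-- The homomorphism from the free Jordan algebra that fixes the generators. -/
def toPlus (K : Type u) [Field K] [CharZero K] (X : Type v) :
    FreeJordan4 K X →ₙₐ[K] Plus (FreeAs3 K X) :=
  RelFree.lift
    ((isJordan4_iff (K := K)).1 ((isAs3_freeAs3 K X).isJordan4_plus (K := K)))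
    fun x => Plus.of (RelFree.of K (as3Identities K) x)

/-! ### The commutative quotient -/

section Commutative

variable {K : Type u} [Field K] {X : Type v}

theorem isAs3_of_comm {A : Type w} [NonUnitalCommRing A] : IsAs3 A where
  assoc := mul_assoc
  third a b c := by
    rw [mul_comm (b * c), mul_comm (c * b), ← mul_assoc, ← mul_assoc, mul_right_comm a c b,
      mul_comm b a]

variable (K X) in
/-- The homomorphism to polynomials. -/
def toPoly : FreeAs3 K X →ₙₐ[K] MvPolynomial X K :=
  RelFree.lift ((isAs3_iff (K := K)).1 isAs3_of_comm) MvPolynomial.X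

@[simp] theorem toPlus_of [CharZero K] (x : X) :
    toPlus K X (RelFree.of K (jordanIdentities K) x) =
      Plus.of (RelFree.of K (as3Identities K) x) :=
  RelFree.lift_of _ _ _

/-- In a commutative algebra `{u, v} = 2uv`, so each of the `l.length - 1` multiplications
contributes a factor 2. -/
theorem toPoly_genMul [CharZero K] {l : List X} (hl : l ≠ []) :
    toPoly K X (toPlus K X (genMul K l)).val =
      MvPolynomial.monomial (l.map fun x => Finsupp.single x 1).sum (2 ^ (l.length - 1) : K) := by
  induction l with
  | nil => exact absurd rfl hl
  | cons x l ih =>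
    have hx : toPoly K X (RelFree.of K (as3Identities K) x) = MvPolynomial.X x :=
      RelFree.lift_of _ _ _
    cases l with
    | nil =>
      simp only [genMul_singleton, toPlus_of, hx]
      simp [MvPolynomial.X]
    | cons y l =>
      rw [genMul_cons_cons, map_mul, Plus.val_mul, map_add, map_mul, map_mul, ih (by simp),
        toPlus_of, hx, mul_comm (MvPolynomial.X x), ← two_mul, MvPolynomial.X,
        MvPolynomial.monomial_mul, ← map_ofNat MvPolynomial.C 2, MvPolynomial.C_mul_monomial]
      simp only [List.map_cons, List.sum_cons, List.length_cons, Nat.add_sub_cancel]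
      rw [add_comm _ (Finsupp.single x 1)]
      congr 1
      ring

variable (K X) in
/-- The linear map that recovers the components of degree different from three. -/
def ofPoly : MvPolynomial X K →ₗ[K] FreeJordan4 K X :=
  (MvPolynomial.basisMonomials X K).constr K fun s =>
    let m := Finsupp.toMultiset s
    -- The order chosen by `toList` is immaterial outside degree three. Constants go to 0, since
    -- `genMul K [] = 0`.
    if m.card = 3 then 0 else ((2 : K) ^ (m.card - 1))⁻¹ • genMul K m.toList

theorem ofPoly_toPoly_genMul [CharZero K] {l : List X} (hl : l ≠ []) :
    ofPoly K X (toPoly K X (toPlus K X (genMul K l)).val) =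
      if l.length = 3 then 0 else genMul K l := by
  have hm : Finsupp.toMultiset (l.map fun x => Finsupp.single x 1).sum = (l : Multiset X) := by
    clear hl
    induction l with
    | nil => simp
    | cons x l ih =>
      rw [List.map_cons, List.sum_cons, map_add, ih, Finsupp.toMultiset_single, one_smul]
      rfl
  have h (s : X →₀ ℕ) (r : K) : MvPolynomial.monomial s r =
      r • MvPolynomial.basisMonomials X K s := by
    simp [MvPolynomial.smul_monomial]
  rw [toPoly_genMul hl, h, map_smul, ofPoly, Module.Basis.constr_basis]
  simp only [hm, Multiset.coe_card]
  split_ifs with h3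
  · rw [smul_zero]
  · rw [smul_inv_smul₀ (pow_ne_zero _ two_ne_zero)]
    have hp : (l : Multiset X).toList.Perm l := Multiset.coe_eq_coe.1 (Multiset.coe_toList _)
    exact genMul_perm hp (by rwa [hp.length_eq])

end Commutative

/-! ### The part of degree three -/

/-- The space `A ⊕ A ⊗ A ⊕ A`, graded in degrees one to three. -/
@[ext] structure Graded3 (K : Type u) [Field K] (A : Type w) [NonUnitalNonAssocRing A]
    [Module K A] where
  /-- The component of degree one. -/
  one : A
  /-- The component of degree two. -/
  two : A ⊗[K] A
  /-- The component of degree three. -/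
  three : A

namespace Graded3

variable {K : Type u} [Field K] {A : Type w} [NonUnitalNonAssocRing A] [Module K A]

variable (K A) in
/-- The components of an element. -/
def equiv : Graded3 K A ≃ A × (A ⊗[K] A) × A where
  toFun a := (a.one, a.two, a.three)
  invFun a := ⟨a.1, a.2.1, a.2.2⟩
  left_inv _ := rfl
  right_inv _ := rfl

instance : AddCommGroup (Graded3 K A) := (equiv K A).addCommGroup

instance : Module K (Graded3 K A) := (equiv K A).module K

@[simp] theorem one_add (a b : Graded3 K A) : (a + b).one = a.one + b.one := rfl
@[simp] theorem two_add (a b : Graded3 K A) : (a + b).two = a.two + b.two := rfl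
@[simp] theorem three_add (a b : Graded3 K A) : (a + b).three = a.three + b.three := rfl
@[simp] theorem one_zero : (0 : Graded3 K A).one = 0 := rfl
@[simp] theorem two_zero : (0 : Graded3 K A).two = 0 := rfl
@[simp] theorem three_zero : (0 : Graded3 K A).three = 0 := rfl
@[simp] theorem one_smul' (r : K) (a : Graded3 K A) : (r • a).one = r • a.one := rfl
@[simp] theorem two_smul' (r : K) (a : Graded3 K A) : (r • a).two = r • a.two := rfl
@[simp] theorem three_smul' (r : K) (a : Graded3 K A) : (r • a).three = r • a.three := rfl

variable (K A) in
/-- The component of degree three, as a linear map. -/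
def threeLin : Graded3 K A →ₗ[K] A where
  toFun := three
  map_add' := three_add
  map_smul' := three_smul'

theorem lift_add' {M : Type*} [AddCommGroup M] [Module K M] (f g : A →ₗ[K] A →ₗ[K] M)
    (t : A ⊗[K] A) :
    TensorProduct.lift (f + g) t = TensorProduct.lift f t + TensorProduct.lift g t :=
  LinearMap.congr_fun (map_add (TensorProduct.uncurry (.id K) A A M) f g) t

theorem lift_smul' {M : Type*} [AddCommGroup M] [Module K M] (r : K) (f : A →ₗ[K] A →ₗ[K] M)
    (t : A ⊗[K] A) : TensorProduct.lift (r • f) t = r • TensorProduct.lift f t :=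
  LinearMap.congr_fun (map_smul (TensorProduct.uncurry (.id K) A A M) r f) t

theorem lift_zero' {M : Type*} [AddCommGroup M] [Module K M] (t : A ⊗[K] A) :
    TensorProduct.lift (0 : A →ₗ[K] A →ₗ[K] M) t = 0 :=
  LinearMap.congr_fun (map_zero (TensorProduct.uncurry (.id K) A A M)) t

variable [IsScalarTower K A A] [SMulCommClass K A A]

variable (K A) in
/-- The trilinear map `(a, b, c) ↦ (ab)c`. -/
def mul₃ : A →ₗ[K] A →ₗ[K] A →ₗ[K] A := (LinearMap.mul K A).compr₂ (LinearMap.mul K A)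

variable (K A) in
/-- The trilinear map `(a, b, c) ↦ ((ab)c + 5 (bc)a - 3 (ac)b) / 12`. It is a left inverse of
`(a, b, c) ↦ {{a, b}, c}` in degree three. -/
def tri : A →ₗ[K] A →ₗ[K] A →ₗ[K] A :=
  let T := LinearMap.lflip.toLinearMap ∘ₗ mul₃ K A
  -- Over commutative `A` the coefficients 1/12, 5/12, -1/4 are forced: the sum over swapping the
  -- first two arguments must be totally symmetric, and `{{a, b}, c}` must return `(ab)c`.
  (12 : K)⁻¹ • (mul₃ K A + (5 : K) • T.flip - (3 : K) • T)

theorem tri_apply (a b c : A) :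
    tri K A a b c = (12 : K)⁻¹ • (a * b * c + (5 : K) • (b * c * a) - (3 : K) • (a * c * b)) :=
  rfl

/-- Keeping the full tensor square in degree two lets any trilinear map serve as the triple product;
all terms of degree four or more are dropped. -/
instance : Mul (Graded3 K A) where
  mul a b := ⟨0, a.one ⊗ₜ b.one,
    TensorProduct.lift (tri K A a.one) b.two + TensorProduct.lift (tri K A) a.two b.one⟩

@[simp] theorem one_mul' (a b : Graded3 K A) : (a * b).one = 0 := rfl
@[simp] theorem two_mul' (a b : Graded3 K A) : (a * b).two = a.one ⊗ₜ b.one := rfl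
@[simp] theorem three_mul' (a b : Graded3 K A) : (a * b).three =
    TensorProduct.lift (tri K A a.one) b.two + TensorProduct.lift (tri K A) a.two b.one := rfl

instance : NonUnitalNonAssocRing (Graded3 K A) where
  left_distrib a b c := by ext <;> simp [TensorProduct.tmul_add, add_add_add_comm]
  right_distrib a b c := by ext <;> simp [TensorProduct.add_tmul, lift_add', add_add_add_comm]
  zero_mul a := by ext <;> simp [lift_zero']
  mul_zero a := by ext <;> simp

instance : IsScalarTower K (Graded3 K A) (Graded3 K A) where
  smul_assoc r a b := by ext <;> simp [TensorProduct.smul_tmul', lift_smul']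

instance : SMulCommClass K (Graded3 K A) (Graded3 K A) where
  smul_comm r a b := by ext <;> simp

/-- Both bracketings of a triple product equal `tri` by construction. The third-type identity holds
because `tri a b c + tri b a c` is one sixth of `(ab)c + (bc)a + (ac)b`, which is symmetric in all
three arguments. -/
theorem isAs3 (hA : ∀ a b : A, a * b = b * a) : IsAs3 (Graded3 K A) where
  assoc a b c := by ext <;> simp [lift_zero']
  third a b c := by
    ext
    · simp
    · simp
    · simp only [three_add, three_mul', one_mul', two_mul', map_zero, lift_zero',
        zero_add, TensorProduct.lift.tmul, tri_apply]
      rw [hA b.one a.one, hA c.one b.one, hA c.one a.one]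
      module

/-- The inclusion of the component of degree one. -/
def single (a : A) : Graded3 K A := ⟨a, 0, 0⟩

end Graded3

section Degree3

variable {K : Type u} [Field K] {X : Type v}

variable (K X) in
/-- The homomorphism to the graded space over the free Jordan algebra. -/
def toGraded3 : FreeAs3 K X →ₙₐ[K] Graded3 K (FreeJordan4 K X) :=
  RelFree.lift
    ((isAs3_iff (K := K)).1 (Graded3.isAs3 (isJordan4_freeJordan4 K X).comm))
    fun x => Graded3.single (RelFree.of K (jordanIdentities K) x)

theorem toGraded3_of (x : X) : toGraded3 K X (RelFree.of K (as3Identities K) x) =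
    Graded3.single (RelFree.of K (jordanIdentities K) x) :=
  RelFree.lift_of _ _ _

variable [CharZero K]

theorem toGraded3_genMul_of_four_le {l : List X} (hl : 4 ≤ l.length) :
    toGraded3 K X (toPlus K X (genMul K l)).val = 0 := by
  induction l with
  | nil => simp at hl
  | cons x l ih =>
    match l, hl, ih with
    | [a, b, c], _, _ =>
      ext <;> simp [toGraded3_of, Graded3.single]
    | y :: a :: b :: c :: l, _, ih =>
      rw [genMul_cons_cons, map_mul, Plus.val_mul, map_add, map_mul, map_mul, ih (by simp)]
      simp

/-- In degree three the anti-commutator expands to four values of `tri`, in which the two unwanted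
bracketings cancel and the wanted one has total coefficient 12/12. -/
theorem three_toGraded3_genMul {l : List X} (hl : l ≠ []) :
    (toGraded3 K X (toPlus K X (genMul K l)).val).three =
      if l.length = 3 then genMul K l else 0 := by
  match l, hl with
  | [x], _ => simp [toGraded3_of, Graded3.single]
  | [x, y], _ => simp [toGraded3_of, Graded3.single]
  | [x, y, z], _ =>
    simp [toGraded3_of, Graded3.single, Graded3.tri_apply]
    have hA := (isJordan4_freeJordan4 K X).comm
    generalize RelFree.of K (jordanIdentities K) x = a
    generalize RelFree.of K (jordanIdentities K) y = b
    generalize RelFree.of K (jordanIdentities K) z = c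
    rw [hA b a, hA c a, hA c b]
    module
  | x :: y :: z :: w :: l, _ =>
    rw [toGraded3_genMul_of_four_le (by simp)]
    simp

/-! ### The left inverse and injectivity -/

variable (K X) in
/-- A linear left inverse of `toPlus`. -/
def leftInv : Plus (FreeAs3 K X) →ₗ[K] FreeJordan4 K X :=
  (ofPoly K X ∘ₗ (toPoly K X : FreeAs3 K X →ₗ[K] MvPolynomial X K) +
    Graded3.threeLin K (FreeJordan4 K X) ∘ₗ
      (toGraded3 K X : FreeAs3 K X →ₗ[K] Graded3 K (FreeJordan4 K X))) ∘ₗ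
    Plus.valLin K (FreeAs3 K X)

/-- On a left-normed product exactly one summand of `leftInv` acts, the graded one in degree three
and the polynomial one otherwise. -/
theorem leftInv_comp_toPlus : leftInv K X ∘ₗ
    (toPlus K X : FreeJordan4 K X →ₗ[K] Plus (FreeAs3 K X)) = LinearMap.id := by
  refine LinearMap.ext_on span_genMul ?_
  rintro _ ⟨l, hl, rfl⟩
  change ofPoly K X (toPoly K X (toPlus K X (genMul K l)).val) +
    (toGraded3 K X (toPlus K X (genMul K l)).val).three = genMul K l
  rw [ofPoly_toPoly_genMul hl, three_toGraded3_genMul hl]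
  split_ifs <;> simp

theorem toPlus_injective : Function.Injective (toPlus K X) :=
  Function.LeftInverse.injective (g := leftInv K X) fun a => LinearMap.congr_fun leftInv_comp_toPlus a

end Degree3

end MalcevThird

end

theorem mainTheorem5 (K : Type*) [Field K] [CharZero K] (X : Type*) :
    ∃ φ : MalcevThird.FreeJordan4 K X →ₙₐ[K] MalcevThird.Plus (MalcevThird.FreeAs3 K X),
      (∀ x : X, φ (MalcevThird.RelFree.of K (MalcevThird.jordanIdentities K) x) =
        MalcevThird.Plus.of (MalcevThird.RelFree.of K (MalcevThird.as3Identities K) x)) ∧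
      Function.Injective φ :=
  ⟨MalcevThird.toPlus K X, MalcevThird.toPlus_of, MalcevThird.toPlus_injective⟩
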